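/- Consider a system $\dot x = f(x,t)+l(x,t)u+d(x,t)$, $t\ge 0$, with state $x(t)\in\mathcal X\subset\mathbb R^n$, scalar input $u$, nominal vector fields $f,l$ and an unknown uncertainty $d$, and a continuously differentiable sliding variable $s(x,t)$. Put $$h=\frac{\partial s}{\partial t}+\frac{\partial s}{\partial x}^{T} f,\qquad g=\frac{\partial s}{\partial x}^{T} l,\qquad \Delta f=\frac{\partial s}{\partial x}^{T} d,$$ so that $\dot s=h+gu+\Delta f$, and assume that $g\neq 0$ and $|\Delta f|\le\mu$ on $\mathcal X\times[0,\infty)$ for some (unknown) constant $\mu$. Let $\phi,k,\rho,\hat\mu_0>0$ and apply the feedback and the update law $$u=-\frac1g\left[h+ks+\hat\mu\,\mathrm{sgn}(s)\right],\qquad \dot{\hat\mu}=\begin{cases}\frac1\rho\left[1-\frac{2\phi^2}{(|s|+\phi)^2}\right]&\text{if }\hat\mu\ge0,\\ 0&\text{if }\hat\mu<0,\end{cases}\qquad \hat\mu(0)=\hat\mu_0 .$$ Trajectories $(x,\hat\mu)$ are defined on $[0,\infty)$, are locally absolutely continuous, and satisfy the equations almost everywhere; at the discontinuity $s=0$ any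 value in $[-1,1]$ is allowed for $\mathrm{sgn}(s)$, and at $\hat\mu=0$ with $|s|<(\sqrt2-1)\phi$ any value of $\dot{\hat\mu}$ between $\frac1\rho\left[1-\frac{2\phi^2}{(|s|+\phi)^2}\right]$ and $0$ is allowed. Let $\eta=(\sqrt2-1)\phi$ and $\mathcal S=\{s\in\mathbb R:|s|\ge\eta\}$. Then, whenever $s$ lies in $\mathcal S$, it approaches the boundary $\{\pm\eta\}$ of $\mathcal S$. Precisely, if $s(x(t_0),t_0)\in\mathcal S$ for some $t_0\ge 0$, then one of the following holds: 1. $s(x(t),t)\in\mathcal S$ for all $t\ge t_0$, and $s(x(t),t)$ converges to $\eta$ or to $-\eta$ as $t\to\infty$; 2. there is a finite time $t_1\ge t_0$ at which $s(x(t_1),t_1)\in\{\pm\eta\}$, such that $s(x(t),t)\in\mathcal S$ for all $t\in[t_0,t_1]$ and $s(x(t),t)\notin\mathcal S$ for times $t>t_1$ arbitrarily close to $t_1$. -/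

import Mathlib

open MeasureTheory Set Filter Topology

noncomputable section

/-- A control-affine plant `ẋ = f(x,t) + l(x,t) u + d(x,t)` with state in `stateSet ⊆ ℝⁿ`, together
with a sliding function `s(x,t)`.  The fields `f` and `l` are the nominal vector fields, which the
controller knows; `d` is the lumped model uncertainty, which it does not know. -/
structure UncertainPlant (n : ℕ) where
  stateSet : Set (EuclideanSpace ℝ (Fin n))
  f : EuclideanSpace ℝ (Fin n) → ℝ → EuclideanSpace ℝ (Fin n)
  l : EuclideanSpace ℝ (Fin n) → ℝ → EuclideanSpace ℝ (Fin n)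
  d : EuclideanSpace ℝ (Fin n) → ℝ → EuclideanSpace ℝ (Fin n)
  s : EuclideanSpace ℝ (Fin n) → ℝ → ℝ

namespace UncertainPlant

variable {n : ℕ} (P : UncertainPlant n)

/-- `∂s/∂t + (∂s/∂x)ᵀ f`. -/
def h (x : EuclideanSpace ℝ (Fin n)) (t : ℝ) : ℝ :=
  deriv (fun τ => P.s x τ) t + fderiv ℝ (fun z => P.s z t) x (P.f x t)

/-- `(∂s/∂x)ᵀ l`. -/
def g (x : EuclideanSpace ℝ (Fin n)) (t : ℝ) : ℝ :=
  fderiv ℝ (fun z => P.s z t) x (P.l x t)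

/-- The uncertainty `Δf = (∂s/∂x)ᵀ d` that enters the equation `ṡ = h + g u + Δf`. -/
def deltaF (x : EuclideanSpace ℝ (Fin n)) (t : ℝ) : ℝ :=
  fderiv ℝ (fun z => P.s z t) x (P.d x t)

/-- The standing assumptions: `s` is continuously differentiable, it has relative degree one with
respect to `u` (that is, `g ≠ 0`), and the uncertainty is bounded by `μ`. -/
structure Admissible (μ : ℝ) : Prop where
  smooth : ∀ x ∈ P.stateSet, ∀ t : ℝ, 0 ≤ t →
    ContDiffAt ℝ 1 (fun p : EuclideanSpace ℝ (Fin n) × ℝ => P.s p.1 p.2) (x, t)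
  relDegOne : ∀ x ∈ P.stateSet, ∀ t : ℝ, 0 ≤ t → P.g x t ≠ 0
  bounded : ∀ x ∈ P.stateSet, ∀ t : ℝ, 0 ≤ t → |P.deltaF x t| ≤ μ

end UncertainPlant

/-- `Ψ(s) = 1 - 2φ² / (|s| + φ)²`. -/
def psi (φ s : ℝ) : ℝ := 1 - 2 * φ ^ 2 / (|s| + φ) ^ 2

/-- The right-hand side of the update law for the gain `m = μ̂`. -/
def updateLaw (φ ρ s m : ℝ) : ℝ := if 0 ≤ m then 1 / ρ * psi φ s else 0

/-- The admissible values of `dμ̂/dt`: the value of the update law, except that at `μ̂ = 0` with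
`Ψ(s) < 0`, where the update law jumps from `Ψ(s)/ρ < 0` to `0` across `μ̂ = 0` and no solution in
the ordinary sense exists, every value in between is allowed (Filippov's convention), so that the
gain may rest at zero. -/
def updateSet (φ ρ s m : ℝ) : Set ℝ :=
  if m = 0 ∧ psi φ s < 0 then Icc (1 / ρ * psi φ s) 0 else {updateLaw φ ρ s m}

theorem updateLaw_mem_updateSet (φ ρ s m : ℝ) (hρ : 0 < ρ) :
    updateLaw φ ρ s m ∈ updateSet φ ρ s m := by
  have hρ' : 0 < 1 / ρ := one_div_pos.mpr hρ
  unfold updateSet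
  split_ifs with hm
  · obtain ⟨rfl, hψ⟩ := hm
    simp only [updateLaw, le_refl, if_true, mem_Icc, true_and]
    exact (mul_neg_of_pos_of_neg hρ' hψ).le
  · rfl

/-- The admissible values of `sgn s`: the value `sgn s` for `s ≠ 0`, and every number in `[-1, 1]`
(in particular `sgn 0 = 0`) at the discontinuity `s = 0`. -/
def sgnSet (s : ℝ) : Set ℝ := if s = 0 then Icc (-1) 1 else {Real.sign s}

theorem sign_mem_sgnSet (s : ℝ) : Real.sign s ∈ sgnSet s := by
  unfold sgnSet
  split_ifs with hs
  · subst hs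
    simp
  · rfl

/-- The feedback `u = -(1/g) [h + k s + μ̂ σ]`, where `m = μ̂` and `σ` is the value of `sgn s`. -/
def UncertainPlant.feedback {n : ℕ} (P : UncertainPlant n) (k m σ : ℝ)
    (x : EuclideanSpace ℝ (Fin n)) (t : ℝ) : ℝ :=
  -(1 / P.g x t) * (P.h x t + k * P.s x t + m * σ)

/-- `(x, m)`, with `m = μ̂`, is a trajectory on `[0, ∞)` of the closed loop formed by the plant, the
feedback and the update law, with initial gain `m₀`: both functions are locally absolutely
continuous, the state stays in the state set, and the equations hold at almost every time. -/
structure IsClosedLoopTrajectory {n : ℕ} (P : UncertainPlant n) (φ k ρ m₀ : ℝ)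
    (x : ℝ → EuclideanSpace ℝ (Fin n)) (m : ℝ → ℝ) : Prop where
  ac_state : ∀ T : ℝ, 0 ≤ T → AbsolutelyContinuousOnInterval x 0 T
  ac_gain : ∀ T : ℝ, 0 ≤ T → AbsolutelyContinuousOnInterval m 0 T
  mem_stateSet : ∀ t : ℝ, 0 ≤ t → x t ∈ P.stateSet
  gain_zero : m 0 = m₀
  state_eq : ∀ᵐ t ∂(volume.restrict (Ici (0 : ℝ))), ∃ σ ∈ sgnSet (P.s (x t) t),
    HasDerivAt x (P.f (x t) t + P.feedback k (m t) σ (x t) t • P.l (x t) t + P.d (x t) t) t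
  gain_eq : ∀ᵐ t ∂(volume.restrict (Ici (0 : ℝ))),
    ∃ r ∈ updateSet φ ρ (P.s (x t) t) (m t), HasDerivAt m r t

/-- `η = (√2 - 1) φ`. -/
def etaBound (φ : ℝ) : ℝ := (Real.sqrt 2 - 1) * φ

/-- The domain `𝒮 = {s ∈ ℝ : |s| ≥ η}`. -/
def slidingDomain (φ : ℝ) : Set ℝ := {s : ℝ | etaBound φ ≤ |s|}

end

/-! If `s` leaves `𝒮`, continuity and the infimum of the exit times give the second alternative.
Otherwise `s` never vanishes, so it has a constant sign `ε` and `y = ε s = |s|` satisfies, almost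
everywhere, `y' ≤ -k y - μ̂ + μ` and `μ̂' = Ψ(y)/ρ ≥ 0`.

The gain cannot exceed `μ`, for then `y` would decrease at rate at least `k η` for ever and fall
below `η`. Being monotone and bounded, the gain converges. On the other hand `y'` is bounded above,
so a large value of `y` at time `t` forces `y` to have been large throughout a fixed interval before
`t`, during which the gain grows by a fixed amount; eventually this is impossible. This is
`tendsto_etaBound_of_deriv_le`. No lower bound on `y'` is needed. -/

/-- A function whose increments are controlled by those of an absolutely continuous function and
by the length of the interval is absolutely continuous. -/
theorem AbsolutelyContinuousOnInterval.of_dist_le {X Y : Type*} [PseudoMetricSpace X]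
    [PseudoMetricSpace Y] {f : ℝ → X} {F : ℝ → Y} {a b K : ℝ}
    (hf : AbsolutelyContinuousOnInterval f a b)
    (hF : ∀ u ∈ uIcc a b, ∀ v ∈ uIcc a b,
      dist (F u) (F v) ≤ K * (dist (f u) (f v) + dist u v)) :
    AbsolutelyContinuousOnInterval F a b := by
  have hid : AbsolutelyContinuousOnInterval (fun t : ℝ => t) a b :=
    (LipschitzWith.id.lipschitzOnWith (s := uIcc a b)).absolutelyContinuousOnInterval
  unfold AbsolutelyContinuousOnInterval at hf hid ⊢
  refine squeeze_zero' (Eventually.of_forall fun _ => Finset.sum_nonneg fun i _ => dist_nonneg) ?_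
    (by simpa using (hf.add hid).const_mul K)
  rw [eventually_inf_principal]
  filter_upwards with E hE
  rw [← Finset.sum_add_distrib, Finset.mul_sum]
  exact Finset.sum_le_sum fun i hi => hF _ (hE.1 i hi).1 _ (hE.1 i hi).2

/-- The composition of a function that is `C¹` along a curve with an absolutely continuous curve,
with explicit dependence on time, is absolutely continuous. -/
theorem AbsolutelyContinuousOnInterval.contDiffAt_comp_prodMk {E : Type*} [NormedAddCommGroup E]
    [NormedSpace ℝ E] {x : ℝ → E} {S : E × ℝ → ℝ} {a b : ℝ}
    (hx : AbsolutelyContinuousOnInterval x a b)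
    (hS : ∀ t ∈ uIcc a b, ContDiffAt ℝ 1 S (x t, t)) :
    AbsolutelyContinuousOnInterval (fun t => S (x t, t)) a b := by
  have hcont : ContinuousOn (fun t => (x t, t)) (uIcc a b) := hx.continuousOn.prodMk continuousOn_id
  have hcomp : IsCompact ((fun t => (x t, t)) '' uIcc a b) :=
    isCompact_uIcc.image_of_continuousOn hcont
  have hloc : LocallyLipschitzOn ((fun t => (x t, t)) '' uIcc a b) S := by
    rintro _ ⟨t, ht, rfl⟩
    obtain ⟨K, U, hU, hK⟩ := (hS t ht).exists_lipschitzOnWith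
    exact ⟨K, U, mem_nhdsWithin_of_mem_nhds hU, hK⟩
  obtain ⟨K, hK⟩ := hloc.exists_lipschitzOnWith_of_compact hcomp
  refine hx.of_dist_le (K := K) fun u hu v hv => ?_
  refine (hK.dist_le_mul _ (mem_image_of_mem _ hu) _ (mem_image_of_mem _ hv)).trans ?_
  gcongr
  rw [Prod.dist_eq]
  exact max_le_add_of_nonneg dist_nonneg dist_nonneg

/-- One-sided mean value inequality for absolutely continuous functions. -/
theorem AbsolutelyContinuousOnInterval.sub_le_mul_sub {f : ℝ → ℝ} {a b c : ℝ} (hab : a ≤ b)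
    (hf : AbsolutelyContinuousOnInterval f a b)
    (hd : ∀ᵐ t, t ∈ Ioo a b → ∃ r ≤ c, HasDerivAt f r t) : f b - f a ≤ c * (b - a) := by
  rw [← hf.integral_deriv_eq_sub, mul_comm, ← smul_eq_mul, ← intervalIntegral.integral_const]
  refine intervalIntegral.integral_mono_ae_restrict hab hf.intervalIntegrable_deriv (by simp) ?_
  rw [Measure.restrict_congr_set Ioo_ae_eq_Icc.symm, EventuallyLE,
    ae_restrict_iff' measurableSet_Ioo]
  filter_upwards [hd] with t ht hm
  obtain ⟨r, hr, h⟩ := ht hm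
  rwa [h.deriv]

/-- One-sided mean value inequality for absolutely continuous functions. -/
theorem AbsolutelyContinuousOnInterval.mul_sub_le_sub {f : ℝ → ℝ} {a b c : ℝ} (hab : a ≤ b)
    (hf : AbsolutelyContinuousOnInterval f a b)
    (hd : ∀ᵐ t, t ∈ Ioo a b → ∃ r ≥ c, HasDerivAt f r t) : c * (b - a) ≤ f b - f a := by
  have := hf.fun_neg.sub_le_mul_sub (c := -c) hab (by
    filter_upwards [hd] with t ht hm
    obtain ⟨r, hr, h⟩ := ht hm
    exact ⟨-r, neg_le_neg hr, h.neg⟩)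
  linarith

/-! ### The function `Ψ` and the boundary of `𝒮` -/

theorem etaBound_pos {φ : ℝ} (hφ : 0 < φ) : 0 < etaBound φ := by
  have : 1 < Real.sqrt 2 := Real.lt_sqrt_of_sq_lt (by norm_num)
  exact mul_pos (by linarith) hφ

/-- The threshold `η` is the positive root of `Ψ`, because `η + φ = √2 φ`. -/
theorem psi_etaBound {φ : ℝ} (hφ : 0 < φ) : psi φ (etaBound φ) = 0 := by
  have h : |etaBound φ| + φ = Real.sqrt 2 * φ := by
    rw [abs_of_pos (etaBound_pos hφ), etaBound]; ring
  rw [psi, h, mul_pow, Real.sq_sqrt zero_le_two, div_self (by positivity), sub_self]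

theorem psi_abs (φ s : ℝ) : psi φ |s| = psi φ s := by simp [psi]

theorem psi_mono {φ a b : ℝ} (hφ : 0 < φ) (h : |a| ≤ |b|) : psi φ a ≤ psi φ b := by
  unfold psi
  gcongr

theorem psi_strictMono {φ a b : ℝ} (hφ : 0 < φ) (h : |a| < |b|) : psi φ a < psi φ b := by
  unfold psi
  gcongr

theorem psi_nonneg {φ s : ℝ} (hφ : 0 < φ) (h : etaBound φ ≤ |s|) : 0 ≤ psi φ s := by
  rw [← psi_etaBound hφ]
  exact psi_mono hφ (by rwa [abs_of_pos (etaBound_pos hφ)])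

theorem psi_pos {φ s : ℝ} (hφ : 0 < φ) (h : etaBound φ < |s|) : 0 < psi φ s := by
  rw [← psi_etaBound hφ]
  exact psi_strictMono hφ (by rwa [abs_of_pos (etaBound_pos hφ)])

theorem isClosed_slidingDomain (φ : ℝ) : IsClosed (slidingDomain φ) :=
  isClosed_le continuous_const continuous_abs

/-- A point of `𝒮` that is a limit of points outside `𝒮` is a boundary point of `𝒮`. -/
theorem mem_frontier_slidingDomain {φ s : ℝ} (h : s ∈ slidingDomain φ)
    (h' : s ∈ closure (slidingDomain φ)ᶜ) : s ∈ frontier (slidingDomain φ) := by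
  rw [frontier_eq_closure_inter_closure]
  exact ⟨subset_closure h, h'⟩

theorem sign_mul_etaBound_mem_frontier {φ ε : ℝ} (hφ : 0 < φ) (hε : |ε| = 1) :
    ε * etaBound φ ∈ frontier (slidingDomain φ) := by
  have hη := etaBound_pos hφ
  refine mem_frontier_slidingDomain (by simp [slidingDomain, abs_mul, hε, abs_of_pos hη]) ?_
  have hlim : Tendsto (fun r : ℝ => ε * r) (𝓝[<] etaBound φ) (𝓝 (ε * etaBound φ)) :=
    ((continuous_const.mul continuous_id).tendsto _).mono_left nhdsWithin_le_nhds
  refine mem_closure_of_tendsto hlim ?_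
  filter_upwards [Ioo_mem_nhdsLT hη] with r hr
  simp [slidingDomain, abs_mul, hε, abs_of_pos hr.1, hr.2]

/-- Convergence of the sliding variable on a half-line on which it stays above `η`: the gain
increases and stays bounded, so that its increments over intervals of a fixed length tend to zero,
whereas each excursion of `y` above `η + ε` makes the gain grow by a fixed amount. -/
theorem tendsto_etaBound_of_deriv_le {φ k ρ μ t₀ : ℝ} (hφ : 0 < φ) (hk : 0 < k) (hρ : 0 < ρ)
    {y m : ℝ → ℝ}
    (hy : ∀ a b, t₀ ≤ a → a ≤ b → AbsolutelyContinuousOnInterval y a b)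
    (hm : ∀ a b, t₀ ≤ a → a ≤ b → AbsolutelyContinuousOnInterval m a b)
    (hη : ∀ t, t₀ ≤ t → etaBound φ ≤ y t) (hm0 : ∀ t, t₀ ≤ t → 0 ≤ m t)
    (hy' : ∀ᵐ t, t₀ ≤ t → ∃ r ≤ -(k * y t) - m t + μ, HasDerivAt y r t)
    (hm' : ∀ᵐ t, t₀ ≤ t → HasDerivAt m (1 / ρ * psi φ (y t)) t) :
    Tendsto y atTop (𝓝 (etaBound φ)) := by
  have hη0 := etaBound_pos hφ
  have hypos : ∀ t, t₀ ≤ t → |y t| = y t := fun t ht => abs_of_pos (hη0.trans_le (hη t ht))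
  have hmono : ∀ a b, t₀ ≤ a → a ≤ b → m a ≤ m b := by
    intro a b ha hab
    have := (hm a b ha hab).mul_sub_le_sub (c := 0) hab (by
      filter_upwards [hm'] with t ht hmem
      have htt : t₀ ≤ t := ha.trans hmem.1.le
      refine ⟨_, mul_nonneg (by positivity) (psi_nonneg hφ ?_), ht htt⟩
      rw [hypos t htt]; exact hη t htt)
    linarith
  have hbdd : ∀ t, t₀ ≤ t → m t ≤ μ := by
    intro T hT
    by_contra! hlt
    -- Falling at rate `k η` from time `T`, `y` would be at most `0` at time `b`.
    set b := T + y T / (k * etaBound φ) with hb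
    have hTb : T ≤ b := by
      have := hη0.trans_le (hη T hT)
      have : 0 ≤ y T / (k * etaBound φ) := by positivity
      linarith
    have := (hy T b hT hTb).sub_le_mul_sub (c := -(k * etaBound φ)) hTb (by
      filter_upwards [hy'] with t ht hmem
      have htt : t₀ ≤ t := hT.trans hmem.1.le
      obtain ⟨r, hr, h⟩ := ht htt
      refine ⟨r, hr.trans ?_, h⟩
      have h1 := hmono T t hT hmem.1.le
      have h2 := mul_le_mul_of_nonneg_left (hη t htt) hk.le
      linarith)
    have h1 : -(k * etaBound φ) * (b - T) = - y T := by
      rw [hb]; field_simp; ring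
    have := hη b (hT.trans hTb)
    linarith
  obtain ⟨ℓ, hℓ⟩ : ∃ ℓ, Tendsto m atTop (𝓝 ℓ) := by
    -- Freezing the gain before `t₀` makes it monotone on all of `ℝ`.
    let M : ℝ → ℝ := fun t => m (max t₀ t)
    have hM : Monotone M := fun a b hab => hmono _ _ (le_max_left _ _) (max_le_max le_rfl hab)
    have hMb : BddAbove (range M) := ⟨μ, by rintro _ ⟨t, rfl⟩; exact hbdd _ (le_max_left _ _)⟩
    refine ⟨_, (tendsto_atTop_ciSup hM hMb).congr' ?_⟩
    filter_upwards [eventually_ge_atTop t₀] with t ht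
    simp [M, max_eq_right ht]
  refine tendsto_order.2 ⟨fun c hc => ?_, fun c hc => ?_⟩
  · filter_upwards [eventually_ge_atTop t₀] with t ht using hc.trans_le (hη t ht)
  set ε := c - etaBound φ
  have hε0 : 0 < ε := sub_pos.2 hc
  -- A positive upper bound for `y'`. In time `δ` below, `y` rises by at most `M δ = ε / 2`, so `y t
  -- ≥ η + ε` forces `y ≥ η + ε / 2` on `(t - δ, t)`, where the gain grows at rate at least `q`.
  set M := |μ| + 1
  have hM0 : 0 < M := by positivity
  set δ := ε / (2 * M)
  have hδ0 : 0 < δ := by positivity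
  set q := 1 / ρ * psi φ (etaBound φ + ε / 2)
  have hq0 : 0 < q := mul_pos (by positivity) (psi_pos hφ (by
    rw [abs_of_pos (by positivity)]; linarith))
  have hinc : Tendsto (fun t => m t - m (t - δ)) atTop (𝓝 0) := by
    have := hℓ.sub (hℓ.comp (tendsto_atTop_add_const_right atTop (-δ) tendsto_id))
    simpa [Function.comp_def, sub_eq_add_neg] using this
  filter_upwards [hinc.eventually (gt_mem_nhds (mul_pos hq0 hδ0)),
    eventually_ge_atTop (t₀ + δ)] with t hlt ht
  by_contra! hct
  have hlow : ∀ u ∈ Ioo (t - δ) t, etaBound φ + ε / 2 ≤ y u := by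
    intro u hu
    have hu0 : t₀ ≤ u := by linarith [hu.1]
    have := (hy u t hu0 hu.2.le).sub_le_mul_sub (c := M) hu.2.le (by
      filter_upwards [hy'] with v hv hmem
      have hvv : t₀ ≤ v := hu0.trans hmem.1.le
      obtain ⟨r, hr, h⟩ := hv hvv
      refine ⟨r, hr.trans ?_, h⟩
      have h1 := hm0 v hvv
      have h2 := mul_nonneg hk.le (hη0.le.trans (hη v hvv))
      linarith [le_abs_self μ])
    have h3 : M * (t - u) ≤ M * δ := by
      gcongr
      linarith [hu.1]
    have h4 : M * δ = ε / 2 := by simp only [δ]; field_simp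
    linarith
  have := (hm (t - δ) t (by linarith) (by linarith)).mul_sub_le_sub (c := q) (by linarith) (by
    filter_upwards [hm'] with u hu hmem
    have huu : t₀ ≤ u := by linarith [hmem.1]
    refine ⟨_, ?_, hu huu⟩
    simp only [q, ge_iff_le]
    gcongr
    refine psi_mono hφ ?_
    rw [hypos u huu, abs_of_pos (by positivity)]
    exact hlow u hmem)
  rw [sub_sub_cancel] at this
  linarith

/-! ### Dynamics of the sliding variable -/

namespace UncertainPlant

variable {n : ℕ} {P : UncertainPlant n} {μ : ℝ}

/-- Chain rule for the sliding variable along a curve. -/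
theorem Admissible.hasDerivAt_s (hP : P.Admissible μ) {x : ℝ → EuclideanSpace ℝ (Fin n)}
    {v : EuclideanSpace ℝ (Fin n)} {t : ℝ} (ht : 0 ≤ t) (hxt : x t ∈ P.stateSet)
    (hx : HasDerivAt x v t) :
    HasDerivAt (fun τ => P.s (x τ) τ)
      (deriv (fun τ => P.s (x t) τ) t + fderiv ℝ (fun z => P.s z t) (x t) v) t := by
  have hS := ((hP.smooth _ hxt t ht).differentiableAt one_ne_zero).hasFDerivAt
  set L := fderiv ℝ (fun p : EuclideanSpace ℝ (Fin n) × ℝ => P.s p.1 p.2) (x t, t)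
  have h1 : HasDerivAt (fun τ => P.s (x τ) τ) (L (v, 1)) t :=
    hS.comp_hasDerivAt (f := fun τ => (x τ, τ)) t (hx.prodMk (hasDerivAt_id t))
  have h2 : HasDerivAt (fun τ => P.s (x t) τ) (L (0, 1)) t :=
    hS.comp_hasDerivAt (f := fun τ => (x t, τ)) t ((hasDerivAt_const t (x t)).prodMk (hasDerivAt_id t))
  have h3 : HasFDerivAt (fun z => P.s z t) (L.comp (ContinuousLinearMap.inl ℝ _ ℝ)) (x t) :=
    HasFDerivAt.comp (f := fun z => (z, t)) (x t) hS (hasFDerivAt_prodMk_left (x t) t)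
  rw [h2.deriv, h3.fderiv, ContinuousLinearMap.comp_apply, ContinuousLinearMap.inl_apply,
    ← map_add]
  simpa using h1

/-- The closed-loop equation `ṡ = -k s - μ̂ σ + Δf` of the sliding variable. -/
theorem Admissible.hasDerivAt_s_feedback (hP : P.Admissible μ)
    {x : ℝ → EuclideanSpace ℝ (Fin n)} {k m σ t : ℝ} (ht : 0 ≤ t) (hxt : x t ∈ P.stateSet)
    (hx : HasDerivAt x (P.f (x t) t + P.feedback k m σ (x t) t • P.l (x t) t + P.d (x t) t) t) :
    HasDerivAt (fun τ => P.s (x τ) τ)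
      (-(k * P.s (x t) t) - m * σ + P.deltaF (x t) t) t := by
  convert hP.hasDerivAt_s ht hxt hx using 1
  have hg := hP.relDegOne _ hxt t ht
  have hu : P.feedback k m σ (x t) t * P.g (x t) t
      = -(P.h (x t) t + k * P.s (x t) t + m * σ) := by
    rw [feedback]; field_simp
  rw [map_add, map_add, map_smul, smul_eq_mul]
  change _ = _ + (_ + _ * P.g (x t) t + P.deltaF (x t) t)
  rw [hu, h]
  ring

end UncertainPlant

/-! ### Closed-loop trajectories -/

namespace IsClosedLoopTrajectory

variable {n : ℕ} {P : UncertainPlant n} {μ φ k ρ m₀ : ℝ} {x : ℝ → EuclideanSpace ℝ (Fin n)}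
  {m : ℝ → ℝ}

theorem absolutelyContinuousOnInterval_gain (hx : IsClosedLoopTrajectory P φ k ρ m₀ x m)
    (a b : ℝ) (ha : 0 ≤ a) (hab : a ≤ b) : AbsolutelyContinuousOnInterval m a b :=
  (hx.ac_gain b (ha.trans hab)).mono (by
    rw [uIcc_of_le hab, uIcc_of_le (ha.trans hab)]; exact Icc_subset_Icc_left ha)

theorem absolutelyContinuousOnInterval_s (hx : IsClosedLoopTrajectory P φ k ρ m₀ x m)
    (hP : P.Admissible μ) (a b : ℝ) (ha : 0 ≤ a) (hab : a ≤ b) :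
    AbsolutelyContinuousOnInterval (fun t => P.s (x t) t) a b := by
  have hsub : uIcc a b ⊆ uIcc 0 b := by
    rw [uIcc_of_le hab, uIcc_of_le (ha.trans hab)]; exact Icc_subset_Icc_left ha
  refine ((hx.ac_state b (ha.trans hab)).mono hsub).contDiffAt_comp_prodMk
    (S := fun p => P.s p.1 p.2) fun t ht => ?_
  rw [uIcc_of_le hab] at ht
  exact hP.smooth _ (hx.mem_stateSet t (ha.trans ht.1)) t (ha.trans ht.1)

theorem continuousOn_s (hx : IsClosedLoopTrajectory P φ k ρ m₀ x m) (hP : P.Admissible μ) :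
    ContinuousOn (fun t => P.s (x t) t) (Ici 0) := by
  intro t ht
  have h := (hx.absolutelyContinuousOnInterval_s hP 0 (t + 1) le_rfl
    (by linarith [mem_Ici.1 ht])).continuousOn
  rw [uIcc_of_le (by linarith [mem_Ici.1 ht])] at h
  refine (h t ⟨ht, by linarith⟩).mono_of_mem_nhdsWithin ?_
  rw [← Ici_inter_Iic]
  exact inter_mem self_mem_nhdsWithin (mem_nhdsWithin_of_mem_nhds (Iic_mem_nhds (by linarith)))

/-- The gain never becomes negative. -/
theorem gain_nonneg (hx : IsClosedLoopTrajectory P φ k ρ m₀ x m) (hm₀ : 0 ≤ m₀) {T : ℝ}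
    (hT : 0 ≤ T) : 0 ≤ m T := by
  by_contra! hneg
  have hcont : ContinuousOn m (Icc 0 T) := by
    have := (hx.ac_gain T hT).continuousOn
    rwa [uIcc_of_le hT] at this
  have hcl : IsClosed (Icc 0 T ∩ m ⁻¹' Ici 0) :=
    hcont.preimage_isClosed_of_isClosed isClosed_Icc isClosed_Ici
  have hne : (Icc 0 T ∩ m ⁻¹' Ici 0).Nonempty :=
    ⟨0, ⟨le_rfl, hT⟩, by simpa [hx.gain_zero] using hm₀⟩
  have hbd : BddAbove (Icc 0 T ∩ m ⁻¹' Ici 0) := ⟨T, fun _ h => h.1.2⟩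
  obtain ⟨⟨ha0, haT⟩, ham⟩ := hcl.csSup_mem hne hbd
  -- The last time in `[0, T]` with nonnegative gain; after it the update law freezes the gain, so
  -- `m T ≥ m a`.
  set a := sSup (Icc 0 T ∩ m ⁻¹' Ici 0)
  have := (hx.absolutelyContinuousOnInterval_gain a T ha0 haT).mul_sub_le_sub (c := 0) haT (by
    filter_upwards [(ae_restrict_iff' measurableSet_Ici).1 hx.gain_eq] with t ht hmem
    have ht0 : 0 ≤ t := ha0.trans hmem.1.le
    obtain ⟨r, hr, h⟩ := ht ht0
    have hmt : m t < 0 := by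
      by_contra! hge
      exact hmem.1.not_ge (le_csSup hbd ⟨⟨ht0, hmem.2.le⟩, hge⟩)
    refine ⟨r, ?_, h⟩
    rw [updateSet, if_neg (fun h => hmt.ne h.1), updateLaw, if_neg hmt.not_ge] at hr
    exact (mem_singleton_iff.1 hr).ge)
  have ham' : 0 ≤ m a := ham
  linarith

/-- If the sliding variable stays in `𝒮`, it converges to a boundary point of `𝒮`. -/
theorem exists_tendsto_of_forall_mem (hx : IsClosedLoopTrajectory P φ k ρ m₀ x m)
    (hP : P.Admissible μ) (hφ : 0 < φ) (hk : 0 < k) (hρ : 0 < ρ) (hm₀ : 0 ≤ m₀) {t₀ : ℝ}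
    (ht₀ : 0 ≤ t₀) (hs : ∀ t, t₀ ≤ t → P.s (x t) t ∈ slidingDomain φ) :
    ∃ b ∈ frontier (slidingDomain φ), Tendsto (fun t => P.s (x t) t) atTop (𝓝 b) := by
  have hη0 := etaBound_pos hφ
  have hne : ∀ t ∈ Ici t₀, P.s (x t) t ≠ 0 := fun t ht =>
    abs_pos.1 (hη0.trans_le (hs t ht))
  have hcont : ContinuousOn (fun t => P.s (x t) t) (Ici t₀) :=
    (hx.continuousOn_s hP).mono (Ici_subset_Ici.2 ht₀)
  obtain ⟨ε, hε, hsgn⟩ : ∃ ε : ℝ, (ε = 1 ∨ ε = -1) ∧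
      ∀ t, t₀ ≤ t → Real.sign (P.s (x t) t) = ε := by
    by_cases hall : ∀ t, t₀ ≤ t → 0 < P.s (x t) t
    · exact ⟨1, Or.inl rfl, fun t ht => Real.sign_of_pos (hall t ht)⟩
    refine ⟨-1, Or.inr rfl, fun t ht => Real.sign_of_neg ?_⟩
    push Not at hall
    obtain ⟨u, hu, hsu⟩ := hall
    by_contra! hge
    obtain ⟨w, hw, hw0⟩ := isPreconnected_Ici.intermediate_value (mem_Ici.2 hu) (mem_Ici.2 ht) hcont
      ⟨hsu, hge⟩
    exact hne w hw hw0
  have hε1 : |ε| = 1 := by rcases hε with rfl | rfl <;> simp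
  have hεε : ε * ε = 1 := by rcases hε with rfl | rfl <;> simp
  have habs : ∀ t, t₀ ≤ t → ε * P.s (x t) t = |P.s (x t) t| := by
    intro t ht
    rw [← hsgn t ht, mul_comm]
    rcases (hne t ht).lt_or_gt with h | h
    · rw [Real.sign_of_neg h, abs_of_neg h]; ring
    · rw [Real.sign_of_pos h, abs_of_pos h]; ring
  have key : Tendsto (fun t => ε * P.s (x t) t) atTop (𝓝 (etaBound φ)) := by
    refine tendsto_etaBound_of_deriv_le (μ := μ) (m := m) (t₀ := t₀) hφ hk hρ
      (fun a b ha hab =>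
        (hx.absolutelyContinuousOnInterval_s hP a b (ht₀.trans ha) hab).const_mul ε)
      (fun a b ha hab => hx.absolutelyContinuousOnInterval_gain a b (ht₀.trans ha) hab)
      (fun t ht => (habs t ht).symm ▸ hs t ht)
      (fun t ht => hx.gain_nonneg hm₀ (ht₀.trans ht)) ?_ ?_
    · filter_upwards [(ae_restrict_iff' measurableSet_Ici).1 hx.state_eq] with t ht htt
      have ht0 := ht₀.trans htt
      obtain ⟨σ, hσ, h⟩ := ht ht0
      rw [sgnSet, if_neg (hne t htt), hsgn t htt, mem_singleton_iff] at hσ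
      subst hσ
      refine ⟨_, ?_, (hP.hasDerivAt_s_feedback ht0 (hx.mem_stateSet t ht0) h).const_mul σ⟩
      have hb : σ * P.deltaF (x t) t ≤ μ := by
        refine (le_abs_self _).trans ?_
        rw [abs_mul, hε1, one_mul]
        exact hP.bounded _ (hx.mem_stateSet t ht0) t ht0
      linear_combination hb - m t * hεε
    · filter_upwards [(ae_restrict_iff' measurableSet_Ici).1 hx.gain_eq] with t ht htt
      have ht0 := ht₀.trans htt
      obtain ⟨r, hr, h⟩ := ht ht0
      -- On `𝒮` the interval-valued branch of `updateSet` needs `Ψ < 0` and is excluded.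
      have hψ := psi_nonneg hφ (hs t htt)
      rw [updateSet, if_neg (fun h => hψ.not_gt h.2), updateLaw,
        if_pos (hx.gain_nonneg hm₀ ht0), mem_singleton_iff] at hr
      rwa [habs t htt, psi_abs, ← hr]
  refine ⟨ε * etaBound φ, sign_mul_etaBound_mem_frontier hφ hε1, (key.const_mul ε).congr fun t => ?_⟩
  rw [← mul_assoc, hεε, one_mul]

end IsClosedLoopTrajectory

/-- Whenever the sliding variable lies in the domain `𝒮`, either it leaves `𝒮` after a finite time,
at which it has reached the boundary of `𝒮`, or it stays in `𝒮` for ever and converges to a boundary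
point of `𝒮`. -/
theorem mainTheorem2 {n : ℕ} (P : UncertainPlant n) (μ : ℝ) (hP : P.Admissible μ)
    (φ k ρ m₀ : ℝ) (hφ : 0 < φ) (hk : 0 < k) (hρ : 0 < ρ) (hm₀ : 0 < m₀)
    (x : ℝ → EuclideanSpace ℝ (Fin n)) (m : ℝ → ℝ)
    (hx : IsClosedLoopTrajectory P φ k ρ m₀ x m)
    (t₀ : ℝ) (ht₀ : 0 ≤ t₀) (hs : P.s (x t₀) t₀ ∈ slidingDomain φ) :
    ((∀ t : ℝ, t₀ ≤ t → P.s (x t) t ∈ slidingDomain φ) ∧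
      ∃ b ∈ frontier (slidingDomain φ), Tendsto (fun t : ℝ => P.s (x t) t) atTop (𝓝 b)) ∨
    (∃ t₁ : ℝ, t₀ ≤ t₁ ∧ P.s (x t₁) t₁ ∈ frontier (slidingDomain φ) ∧
      (∀ t ∈ Icc t₀ t₁, P.s (x t) t ∈ slidingDomain φ) ∧
      ∀ ε > 0, ∃ t ∈ Ioo t₁ (t₁ + ε), P.s (x t) t ∉ slidingDomain φ) := by
  by_cases hall : ∀ t : ℝ, t₀ ≤ t → P.s (x t) t ∈ slidingDomain φ
  · exact Or.inl ⟨hall, hx.exists_tendsto_of_forall_mem hP hφ hk hρ hm₀.le ht₀ hall⟩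
  right
  push Not at hall
  obtain ⟨w, hw, hws⟩ := hall
  have hcont : ContinuousOn (fun t => P.s (x t) t) (Ici t₀) :=
    (hx.continuousOn_s hP).mono (Ici_subset_Ici.2 ht₀)
  -- The infimum `t₁` of `A` is not attained, since `s` still lies in `𝒮` at `t₁`: by closedness of
  -- `𝒮`, or by hypothesis if `t₁ = t₀`. Hence exit times accumulate at `t₁` from the right.
  set A : Set ℝ := {t | t₀ ≤ t ∧ P.s (x t) t ∉ slidingDomain φ}
  have hAne : A.Nonempty := ⟨w, hw, hws⟩
  have hAb : BddBelow A := ⟨t₀, fun t ht => ht.1⟩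
  set t₁ := sInf A
  have h01 : t₀ ≤ t₁ := le_csInf hAne fun t ht => ht.1
  have hbefore : ∀ t ∈ Ico t₀ t₁, P.s (x t) t ∈ slidingDomain φ := by
    intro t ht
    by_contra hns
    exact ht.2.not_ge (csInf_le hAb ⟨ht.1, hns⟩)
  have hat : P.s (x t₁) t₁ ∈ slidingDomain φ := by
    rcases h01.eq_or_lt with h | h
    · rwa [← h]
    have hlim : Tendsto (fun t => P.s (x t) t) (𝓝[Ico t₀ t₁] t₁) (𝓝 (P.s (x t₁) t₁)) :=
      (hcont t₁ h01).mono_left (nhdsWithin_mono _ fun t ht => ht.1)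
    have : (𝓝[Ico t₀ t₁] t₁).NeBot := by
      rw [← mem_closure_iff_nhdsWithin_neBot, closure_Ico h.ne]
      exact right_mem_Icc.2 h.le
    exact (isClosed_slidingDomain φ).mem_of_tendsto hlim
      (eventually_mem_nhdsWithin.mono hbefore)
  have hafter : ∀ ε > 0, ∃ t ∈ Ioo t₁ (t₁ + ε), P.s (x t) t ∉ slidingDomain φ := by
    intro ε hε
    obtain ⟨t, htA, hlt⟩ := exists_lt_of_csInf_lt hAne (lt_add_of_pos_right t₁ hε)
    refine ⟨t, ⟨(csInf_le hAb htA).lt_of_ne ?_, hlt⟩, htA.2⟩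
    rintro h
    exact htA.2 (h ▸ hat)
  refine ⟨t₁, h01, mem_frontier_slidingDomain hat ?_, fun t ht => ?_, hafter⟩
  · have hlim : Tendsto (fun t => P.s (x t) t) (𝓝[A] t₁) (𝓝 (P.s (x t₁) t₁)) :=
      (hcont t₁ h01).mono_left (nhdsWithin_mono _ fun t ht => ht.1)
    have : (𝓝[A] t₁).NeBot := mem_closure_iff_nhdsWithin_neBot.1 (csInf_mem_closure hAne hAb)
    exact mem_closure_of_tendsto hlim (eventually_mem_nhdsWithin.mono fun t ht => ht.2)
  · rcases ht.2.eq_or_lt with h | h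
    · rwa [h]
    · exact hbefore t ⟨ht.1, h⟩
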